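/- Let $a_{02},a_{20}$ be real numbers with $a_{02}>0$ (second order coefficients of the normal form $(u,v)\mapsto\bigl(u,\;uv+\cdots,\;\tfrac12a_{20}u^2+a_{11}uv+\tfrac12a_{02}v^2+\cdots\bigr)$ of a Whitney umbrella). For $\theta\in\mathbb R$ put $$F_k(\theta)=(4a_{02}+a_{20})\cos^4\theta+(a_{02}-a_{20})\cos^2\theta\,\sin^2\theta+(a_{02}+2a_{20})\sin^4\theta ,$$ and let $T=-(3a_{02}+7a_{20})(5a_{02}+a_{20})$. Where $\sin\theta\neq0$, put $s=\cos\theta/\sin\theta$; then $F_k(\theta)=\sin^4\theta\;p(s)$ with $p(s)=(4a_{02}+a_{20})s^4+(a_{02}-a_{20})s^2+(a_{02}+2a_{20})$. Assume $a_{02}\neq a_{20}$ and $4a_{02}+a_{20}\neq0$. Then every real root $\theta$ of $F_k(\theta)=0$ satisfies $\sin\theta\ne 0$, and the real roots are exactly the $\theta$ with - $s=\pm\sqrt{\dfrac{a_{20}-a_{02}+\sqrt T}{2(4a_{02}+a_{20})}}$ if $-4a_{02}<a_{20}<-\tfrac12a_{02}$; - $s=\pm\sqrt{\dfrac{a_{20}-a_{02}\pm\sqrt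 T}{2(4a_{02}+a_{20})}}$ (all four choices of signs) if $-5a_{02}\le a_{20}<-4a_{02}$; - $s=0$, which is a double root of $p$, if $a_{20}=-\tfrac12a_{02}$; and there is no real root otherwise. In the first two cases $T\ge 0$ and the quantities under the outer square roots are positive. Moreover, if $4a_{02}+a_{20}=0$, then the real roots of $F_k(\theta)=0$ with $\sin\theta\neq0$ are exactly $\theta=\pm\cot^{-1}\bigl(\sqrt{7/5}\bigr)$ up to integer multiples of $\pi$. -/

import Mathlib

open Polynomial

/-- The function `F_k(θ)` attached to the second order coefficients `a₀₂`, `a₂₀` of the normal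
form `(u, v) ↦ (u, u v + ⋯, a₂₀ u² / 2 + a₁₁ u v + a₀₂ v² / 2 + ⋯)` of a Whitney umbrella. -/
noncomputable def Fk (a02 a20 θ : ℝ) : ℝ :=
  (4 * a02 + a20) * Real.cos θ ^ 4
    + (a02 - a20) * Real.cos θ ^ 2 * Real.sin θ ^ 2
    + (a02 + 2 * a20) * Real.sin θ ^ 4

/-- The polynomial in `s = cos θ / sin θ` obtained from `F_k(θ)` by dividing by `sin⁴ θ`. -/
noncomputable def pk (a02 a20 : ℝ) : ℝ[X] :=
  C (4 * a02 + a20) * X ^ 4 + C (a02 - a20) * X ^ 2 + C (a02 + 2 * a20)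

/-- The quantity `T`, the discriminant of `F_k` as a quadratic in `s²`. -/
def Tk (a02 a20 : ℝ) : ℝ := -(3 * a02 + 7 * a20) * (5 * a02 + a20)

/-- The inverse cotangent with values in `(0, π)`. -/
noncomputable def arccot (x : ℝ) : ℝ := Real.pi / 2 - Real.arctan x

/-!
Dividing `F_k(θ)` by `sin⁴ θ` gives a biquadratic polynomial in `s = cot θ`, and `F_k` does not
vanish where `sin θ = 0` as long as its leading coefficient `a = 4 a₀₂ + a₂₀` is nonzero. Viewed as
a quadratic in `s²`, the polynomial has discriminant `T`, and the real `s` are the square roots of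
its nonnegative roots. With `b = a₀₂ - a₂₀` and `c = a₀₂ + 2 a₂₀`, exactly one of these roots is
positive if `c < 0 < a`, because then `√T > |b|`; both are if `a, c < 0 < b` and `0 ≤ T`, because
then `√T < b`. If `c = 0`, the factor `s²` splits off and the cofactor `a s² + b` is positive.
Elsewhere either `T < 0` or `a`, `b`, `c` are all nonnegative with `0 < c`, and there is no real
root.
-/

section Biquadratic

/-- The biquadratic polynomial with coefficients `a`, `b`, `c`, that is, the quadratic polynomial
with these coefficients evaluated at `X ^ 2`; `pk` is of this form. The coefficient `a` may be zero,
which is what happens to `pk` for `4 * a02 + a20 = 0`. -/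
noncomputable def biquadratic {R : Type*} [Semiring R] (a b c : R) : R[X] :=
  C a * X ^ 4 + C b * X ^ 2 + C c

theorem eval_biquadratic {R : Type*} [Semiring R] (a b c s : R) :
    (biquadratic a b c).eval s = a * s ^ 4 + b * s ^ 2 + c := by
  simp only [biquadratic, eval_add, eval_C_mul, eval_X_pow, eval_C]

theorem isRoot_biquadratic_iff {R : Type*} [Semiring R] {a b c s : R} :
    (biquadratic a b c).IsRoot s ↔ a * (s ^ 2 * s ^ 2) + b * s ^ 2 + c = 0 := by
  rw [IsRoot.def, eval_biquadratic, ← pow_add]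

theorem rootMultiplicity_zero_biquadratic {R : Type*} [CommRing R] (a : R) {b : R} (hb : b ≠ 0) :
    (biquadratic a b 0).rootMultiplicity 0 = 2 := by
  have hfactor : biquadratic a b 0 = (C a * X ^ 2 + C b) * X ^ 2 := by
    rw [biquadratic, C_0]
    ring
  have hcoeff : (C a * X ^ 2 + C b).coeff 0 ≠ 0 := by simpa using hb
  have hne : C a * X ^ 2 + C b ≠ 0 := fun h => hcoeff (by rw [h, coeff_zero])
  rw [rootMultiplicity_eq_natTrailingDegree', hfactor, natTrailingDegree_mul_X_pow hne,
    natTrailingDegree_eq_zero.2 (Or.inr hcoeff)]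

section Field

variable {K : Type*} [Field K] {a b c : K}

theorem pow_four_mul_eval_biquadratic_div (a b c x : K) {y : K} (hy : y ≠ 0) :
    y ^ 4 * (biquadratic a b c).eval (x / y) = a * x ^ 4 + b * x ^ 2 * y ^ 2 + c * y ^ 4 := by
  rw [eval_biquadratic]
  field_simp

theorem biquadratic_form_eq_zero_iff (ha : a ≠ 0) {x y : K} (hxy : y = 0 → x ≠ 0) :
    a * x ^ 4 + b * x ^ 2 * y ^ 2 + c * y ^ 4 = 0 ↔
      y ≠ 0 ∧ (biquadratic a b c).IsRoot (x / y) := by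
  by_cases hy : y = 0
  · simp [hy, ha, hxy hy]
  · rw [← pow_four_mul_eval_biquadratic_div a b c x hy, mul_eq_zero_iff_left (pow_ne_zero 4 hy),
      IsRoot.def, and_iff_right hy]

theorem isRoot_biquadratic_iff_of_discrim_eq_mul_self [NeZero (2 : K)] (ha : a ≠ 0) {d : K}
    (hd : discrim a b c = d * d) (s : K) :
    (biquadratic a b c).IsRoot s ↔
      s ^ 2 = (-b + d) / (2 * a) ∨ s ^ 2 = (-b - d) / (2 * a) := by
  rw [isRoot_biquadratic_iff, quadratic_eq_zero_iff ha hd]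

theorem isRoot_biquadratic_zero_left_iff (hb : b ≠ 0) (s : K) :
    (biquadratic 0 b c).IsRoot s ↔ s ^ 2 = -c / b := by
  rw [isRoot_biquadratic_iff, zero_mul, zero_add, add_eq_zero_iff_eq_neg, eq_div_iff hb, mul_comm]

end Field

section LinearOrder

variable {R : Type*} [CommRing R] [LinearOrder R] [IsStrictOrderedRing R] {a b c : R}

theorem not_isRoot_biquadratic_of_discrim_neg (h : discrim a b c < 0) (s : R) :
    ¬ (biquadratic a b c).IsRoot s := by
  rw [isRoot_biquadratic_iff]
  exact quadratic_ne_zero_of_discrim_ne_sq (fun r => (h.trans_le (sq_nonneg r)).ne) _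

theorem not_isRoot_biquadratic_of_nonneg (ha : 0 ≤ a) (hb : 0 ≤ b) (hc : 0 < c) (s : R) :
    ¬ (biquadratic a b c).IsRoot s := by
  rw [IsRoot.def, eval_biquadratic]
  positivity

theorem isRoot_biquadratic_zero_right_iff (ha : 0 ≤ a) (hb : 0 < b) (s : R) :
    (biquadratic a b 0).IsRoot s ↔ s = 0 := by
  have hpos : 0 < a * s ^ 2 + b := by positivity
  rw [IsRoot.def, eval_biquadratic,
    show a * s ^ 4 + b * s ^ 2 + 0 = (a * s ^ 2 + b) * s ^ 2 by ring,
    mul_eq_zero_iff_left hpos.ne', pow_eq_zero_iff two_ne_zero]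

theorem sq_lt_discrim_iff : b ^ 2 < discrim a b c ↔ a * c < 0 := by
  rw [discrim]
  constructor <;> intro h <;> linarith

theorem discrim_lt_sq_iff : discrim a b c < b ^ 2 ↔ 0 < a * c := by
  rw [discrim]
  constructor <;> intro h <;> linarith

end LinearOrder

section Real

variable {a b c : ℝ}

theorem sq_eq_iff_eq_sqrt_or_eq_neg_sqrt {s t : ℝ} (ht : 0 ≤ t) :
    s ^ 2 = t ↔ s = √t ∨ s = -√t := by
  rw [← sq_eq_sq_iff_eq_or_eq_neg, Real.sq_sqrt ht]

theorem isRoot_biquadratic_iff_of_discrim_nonneg (ha : a ≠ 0) (hdiscrim : 0 ≤ discrim a b c)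
    (s : ℝ) :
    (biquadratic a b c).IsRoot s ↔
      s ^ 2 = (-b + √(discrim a b c)) / (2 * a) ∨ s ^ 2 = (-b - √(discrim a b c)) / (2 * a) :=
  isRoot_biquadratic_iff_of_discrim_eq_mul_self ha (Real.mul_self_sqrt hdiscrim).symm s

theorem abs_lt_sqrt_discrim (h : a * c < 0) : |b| < √(discrim a b c) := by
  rw [Real.lt_sqrt (abs_nonneg b), sq_abs]
  exact sq_lt_discrim_iff.2 h

theorem sqrt_discrim_lt (hb : 0 < b) (h : 0 < a * c) : √(discrim a b c) < b :=
  (Real.sqrt_lt' hb).2 (discrim_lt_sq_iff.2 h)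

theorem neg_add_sqrt_discrim_div_pos (ha : 0 < a) (hc : c < 0) :
    0 < (-b + √(discrim a b c)) / (2 * a) := by
  have hsqrt : b < √(discrim a b c) :=
    (le_abs_self b).trans_lt (abs_lt_sqrt_discrim (mul_neg_of_pos_of_neg ha hc))
  exact div_pos (by linarith) (by positivity)

theorem neg_sub_sqrt_discrim_div_neg (ha : 0 < a) (hc : c < 0) :
    (-b - √(discrim a b c)) / (2 * a) < 0 := by
  have hsqrt : -b < √(discrim a b c) :=
    (neg_le_abs b).trans_lt (abs_lt_sqrt_discrim (mul_neg_of_pos_of_neg ha hc))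
  exact div_neg_of_neg_of_pos (by linarith) (by positivity)

theorem neg_add_sqrt_discrim_div_pos_of_neg (ha : a < 0) (hb : 0 < b) (hc : c < 0) :
    0 < (-b + √(discrim a b c)) / (2 * a) :=
  div_pos_of_neg_of_neg (by linarith [sqrt_discrim_lt hb (mul_pos_of_neg_of_neg ha hc)])
    (by linarith)

theorem neg_sub_sqrt_discrim_div_pos_of_neg (ha : a < 0) (hb : 0 < b) :
    0 < (-b - √(discrim a b c)) / (2 * a) :=
  div_pos_of_neg_of_neg (by linarith [Real.sqrt_nonneg (discrim a b c)]) (by linarith)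

theorem isRoot_biquadratic_iff_of_pos_of_neg (ha : 0 < a) (hc : c < 0) (s : ℝ) :
    (biquadratic a b c).IsRoot s ↔
      s = √((-b + √(discrim a b c)) / (2 * a)) ∨ s = -√((-b + √(discrim a b c)) / (2 * a)) := by
  have hdiscrim : 0 ≤ discrim a b c :=
    (sq_nonneg b).trans (sq_lt_discrim_iff.2 (mul_neg_of_pos_of_neg ha hc)).le
  have hminus : s ^ 2 ≠ (-b - √(discrim a b c)) / (2 * a) :=
    ((neg_sub_sqrt_discrim_div_neg ha hc).trans_le (sq_nonneg s)).ne'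
  rw [isRoot_biquadratic_iff_of_discrim_nonneg ha.ne' hdiscrim, or_iff_left hminus,
    sq_eq_iff_eq_sqrt_or_eq_neg_sqrt (neg_add_sqrt_discrim_div_pos ha hc).le]

theorem isRoot_biquadratic_iff_of_neg_of_pos_of_neg (ha : a < 0) (hb : 0 < b) (hc : c < 0)
    (hdiscrim : 0 ≤ discrim a b c) (s : ℝ) :
    (biquadratic a b c).IsRoot s ↔
      s = √((-b + √(discrim a b c)) / (2 * a)) ∨ s = -√((-b + √(discrim a b c)) / (2 * a)) ∨
      s = √((-b - √(discrim a b c)) / (2 * a)) ∨ s = -√((-b - √(discrim a b c)) / (2 * a)) := by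
  rw [isRoot_biquadratic_iff_of_discrim_nonneg ha.ne hdiscrim,
    sq_eq_iff_eq_sqrt_or_eq_neg_sqrt (neg_add_sqrt_discrim_div_pos_of_neg ha hb hc).le,
    sq_eq_iff_eq_sqrt_or_eq_neg_sqrt (neg_sub_sqrt_discrim_div_pos_of_neg ha hb).le, or_assoc]

end Real

end Biquadratic

section Cotangent

theorem cot_neg (θ : ℝ) : Real.cot (-θ) = -Real.cot θ := by
  simp only [Real.cot_eq_cos_div_sin, Real.cos_neg, Real.sin_neg, div_neg]

theorem cot_eq_cot_iff {θ φ : ℝ} (hθ : Real.sin θ ≠ 0) (hφ : Real.sin φ ≠ 0) :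
    Real.cot θ = Real.cot φ ↔ ∃ n : ℤ, θ = φ + n * Real.pi := by
  have hsin : Real.cot θ = Real.cot φ ↔ Real.sin (θ - φ) = 0 := by
    rw [Real.cot_eq_cos_div_sin, Real.cot_eq_cos_div_sin, div_eq_div_iff hθ hφ, Real.sin_sub,
      sub_eq_zero, eq_comm, mul_comm (Real.cos φ)]
  rw [hsin, Real.sin_eq_zero_iff]
  exact exists_congr fun n => by rw [eq_sub_iff_add_eq', eq_comm]

theorem sin_arccot_pos (x : ℝ) : 0 < Real.sin (arccot x) := by
  rw [arccot, Real.sin_pi_div_two_sub]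
  exact Real.cos_arctan_pos x

theorem cot_arccot (x : ℝ) : Real.cot (arccot x) = x := by
  rw [← inv_inv (Real.cot _), Real.cot_inv_eq_tan, arccot, Real.tan_pi_div_two_sub, inv_inv,
    Real.tan_arctan]

theorem cot_eq_iff_exists_arccot {θ : ℝ} (hθ : Real.sin θ ≠ 0) (x : ℝ) :
    Real.cot θ = x ↔ ∃ n : ℤ, θ = arccot x + n * Real.pi := by
  rw [← cot_eq_cot_iff hθ (sin_arccot_pos x).ne', cot_arccot]

theorem cot_eq_neg_iff_exists_arccot {θ : ℝ} (hθ : Real.sin θ ≠ 0) (x : ℝ) :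
    Real.cot θ = -x ↔ ∃ n : ℤ, θ = -arccot x + n * Real.pi := by
  have hsin : Real.sin (-arccot x) ≠ 0 := by
    rw [Real.sin_neg]
    exact neg_ne_zero.2 (sin_arccot_pos x).ne'
  rw [← cot_eq_cot_iff hθ hsin, cot_neg, cot_arccot]

end Cotangent

section WhitneyUmbrella

theorem pk_eq_biquadratic (a02 a20 : ℝ) :
    pk a02 a20 = biquadratic (4 * a02 + a20) (a02 - a20) (a02 + 2 * a20) :=
  rfl

theorem Tk_eq_discrim (a02 a20 : ℝ) :
    Tk a02 a20 = discrim (4 * a02 + a20) (a02 - a20) (a02 + 2 * a20) := by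
  rw [Tk, discrim]
  ring

theorem Fk_eq_sin_pow_mul_eval (a02 a20 : ℝ) {θ : ℝ} (hθ : Real.sin θ ≠ 0) :
    Fk a02 a20 θ = Real.sin θ ^ 4 * (pk a02 a20).eval (Real.cos θ / Real.sin θ) :=
  (pow_four_mul_eval_biquadratic_div _ _ _ _ hθ).symm

variable {a02 a20 : ℝ}

theorem Fk_eq_zero_iff (ha : 4 * a02 + a20 ≠ 0) (θ : ℝ) :
    Fk a02 a20 θ = 0 ↔
      Real.sin θ ≠ 0 ∧ (pk a02 a20).IsRoot (Real.cos θ / Real.sin θ) := by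
  have hcos : Real.sin θ = 0 → Real.cos θ ≠ 0 := fun hsin hcos => by
    simpa [hsin, hcos] using Real.sin_sq_add_cos_sq θ
  exact biquadratic_form_eq_zero_iff ha hcos

theorem Tk_nonneg_iff (ha02 : 0 < a02) :
    0 ≤ Tk a02 a20 ↔ -5 * a02 ≤ a20 ∧ a20 ≤ -(3 / 7) * a02 := by
  rw [Tk, mul_nonneg_iff]
  constructor
  · rintro (⟨h₁, h₂⟩ | ⟨h₁, h₂⟩) <;> constructor <;> linarith
  · rintro ⟨hlow, hup⟩
    exact Or.inl ⟨by linarith, by linarith⟩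

theorem not_isRoot_pk_of_Tk_neg (hT : Tk a02 a20 < 0) (s : ℝ) : ¬ (pk a02 a20).IsRoot s :=
  not_isRoot_biquadratic_of_discrim_neg (Tk_eq_discrim a02 a20 ▸ hT) s

theorem not_isRoot_pk (ha02 : 0 < a02) (h : a20 < -5 * a02 ∨ -(1 / 2) * a02 < a20) (s : ℝ) :
    ¬ (pk a02 a20).IsRoot s := by
  rcases h with hlow | hlow
  · exact not_isRoot_pk_of_Tk_neg (not_le.1 fun hT => hlow.not_ge ((Tk_nonneg_iff ha02).1 hT).1) s
  rcases le_or_gt a20 a02 with hup | hup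
  · exact not_isRoot_biquadratic_of_nonneg (by linarith) (by linarith) (by linarith) s
  · exact not_isRoot_pk_of_Tk_neg
      (not_le.1 fun hT => by linarith [((Tk_nonneg_iff ha02).1 hT).2]) s

theorem Fk_eq_zero_iff_exists_arccot (ha02 : a02 ≠ 0) (ha : 4 * a02 + a20 = 0) {θ : ℝ}
    (hθ : Real.sin θ ≠ 0) :
    Fk a02 a20 θ = 0 ↔
      ∃ n : ℤ, θ = arccot (√(7 / 5)) + n * Real.pi ∨ θ = -arccot (√(7 / 5)) + n * Real.pi := by
  obtain rfl : a20 = -4 * a02 := by linarith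
  have hb : a02 - -4 * a02 ≠ 0 := by
    rw [show a02 - -4 * a02 = 5 * a02 by ring]
    positivity
  have hsq : -(a02 + 2 * (-4 * a02)) / (a02 - -4 * a02) = 7 / 5 := by
    rw [div_eq_div_iff hb (by norm_num)]
    ring
  rw [Fk_eq_sin_pow_mul_eval a02 _ hθ, mul_eq_zero_iff_left (pow_ne_zero 4 hθ), ← IsRoot.def,
    pk_eq_biquadratic, ha, isRoot_biquadratic_zero_left_iff hb, hsq,
    sq_eq_iff_eq_sqrt_or_eq_neg_sqrt (by norm_num), ← Real.cot_eq_cos_div_sin, exists_or,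
    cot_eq_iff_exists_arccot hθ, cot_eq_neg_iff_exists_arccot hθ]

end WhitneyUmbrella

theorem theorem4 (a02 a20 : ℝ) (ha02 : 0 < a02) :
    -- substituting `s = cos θ / sin θ` turns `F_k(θ) = 0` into the quartic equation `pk(s) = 0`
    (∀ θ : ℝ, Real.sin θ ≠ 0 →
      Fk a02 a20 θ = Real.sin θ ^ 4 * (pk a02 a20).eval (Real.cos θ / Real.sin θ)) ∧
    (a02 ≠ a20 → 4 * a02 + a20 ≠ 0 →
      -- case `-4 a₀₂ < a₂₀ < -a₀₂ / 2`
      ((-4 * a02 < a20 ∧ a20 < -(1 / 2) * a02) →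
        0 ≤ Tk a02 a20 ∧
        0 < (a20 - a02 + √(Tk a02 a20)) / (2 * (4 * a02 + a20)) ∧
        ∀ θ : ℝ, Fk a02 a20 θ = 0 ↔
          Real.sin θ ≠ 0 ∧
          (Real.cos θ / Real.sin θ = √((a20 - a02 + √(Tk a02 a20)) / (2 * (4 * a02 + a20))) ∨
           Real.cos θ / Real.sin θ = -√((a20 - a02 + √(Tk a02 a20)) / (2 * (4 * a02 + a20))))) ∧
      -- case `-5 a₀₂ ≤ a₂₀ < -4 a₀₂`
      ((-5 * a02 ≤ a20 ∧ a20 < -4 * a02) →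
        0 ≤ Tk a02 a20 ∧
        0 < (a20 - a02 + √(Tk a02 a20)) / (2 * (4 * a02 + a20)) ∧
        0 < (a20 - a02 - √(Tk a02 a20)) / (2 * (4 * a02 + a20)) ∧
        ∀ θ : ℝ, Fk a02 a20 θ = 0 ↔
          Real.sin θ ≠ 0 ∧
          (Real.cos θ / Real.sin θ = √((a20 - a02 + √(Tk a02 a20)) / (2 * (4 * a02 + a20))) ∨
           Real.cos θ / Real.sin θ = -√((a20 - a02 + √(Tk a02 a20)) / (2 * (4 * a02 + a20))) ∨
           Real.cos θ / Real.sin θ = √((a20 - a02 - √(Tk a02 a20)) / (2 * (4 * a02 + a20))) ∨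
           Real.cos θ / Real.sin θ = -√((a20 - a02 - √(Tk a02 a20)) / (2 * (4 * a02 + a20))))) ∧
      -- case `a₂₀ = -a₀₂ / 2`: the only real root is `s = 0`, and it is a double root
      (a20 = -(1 / 2) * a02 →
        (∀ θ : ℝ, Fk a02 a20 θ = 0 ↔ Real.sin θ ≠ 0 ∧ Real.cos θ / Real.sin θ = 0) ∧
        (pk a02 a20).rootMultiplicity 0 = 2) ∧
      -- otherwise: no real root
      (¬ (-4 * a02 < a20 ∧ a20 < -(1 / 2) * a02) →
        ¬ (-5 * a02 ≤ a20 ∧ a20 < -4 * a02) →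
        a20 ≠ -(1 / 2) * a02 →
        ∀ θ : ℝ, Fk a02 a20 θ ≠ 0)) ∧
    (4 * a02 + a20 = 0 →
      -- roots in the domain `sin θ ≠ 0` of `s`; `F_k` has period `π`
      ∀ θ : ℝ, Real.sin θ ≠ 0 →
        (Fk a02 a20 θ = 0 ↔
          ∃ n : ℤ, θ = arccot (√(7 / 5)) + n * Real.pi ∨
            θ = -arccot (√(7 / 5)) + n * Real.pi)) := by
  refine ⟨fun _ => Fk_eq_sin_pow_mul_eval a02 a20, fun hne ha => ?_,
    fun ha _ => Fk_eq_zero_iff_exists_arccot ha02.ne' ha⟩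
  simp only [Fk_eq_zero_iff ha, Tk_eq_discrim, ← neg_sub a02 a20]
  refine ⟨?_, ?_, fun heq => ?_, fun h₁ h₂ h₃ θ hθ => ?_⟩
  · rintro ⟨hlow, hup⟩
    have hpos : 0 < 4 * a02 + a20 := by linarith
    have hc : a02 + 2 * a20 < 0 := by linarith
    have hT : 0 ≤ Tk a02 a20 := (Tk_nonneg_iff ha02).2 ⟨by linarith, by linarith⟩
    exact ⟨Tk_eq_discrim a02 a20 ▸ hT, neg_add_sqrt_discrim_div_pos hpos hc,
      fun θ => and_congr_right' (isRoot_biquadratic_iff_of_pos_of_neg hpos hc _)⟩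
  · rintro ⟨hlow, hup⟩
    have hneg : 4 * a02 + a20 < 0 := by linarith
    have hb : 0 < a02 - a20 := by linarith
    have hc : a02 + 2 * a20 < 0 := by linarith
    have hT : 0 ≤ Tk a02 a20 := (Tk_nonneg_iff ha02).2 ⟨hlow, by linarith⟩
    rw [Tk_eq_discrim] at hT
    exact ⟨hT, neg_add_sqrt_discrim_div_pos_of_neg hneg hb hc,
      neg_sub_sqrt_discrim_div_pos_of_neg hneg hb, fun θ => and_congr_right'
        (isRoot_biquadratic_iff_of_neg_of_pos_of_neg hneg hb hc hT _)⟩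
  · have hc : a02 + 2 * a20 = 0 := by linarith
    rw [pk_eq_biquadratic, hc]
    exact ⟨fun θ => and_congr_right' (isRoot_biquadratic_zero_right_iff (by linarith)
      (by linarith) _), rootMultiplicity_zero_biquadratic _ (sub_ne_zero.2 hne)⟩
  · have hrange : a20 < -5 * a02 ∨ -(1 / 2) * a02 < a20 := by grind
    exact not_isRoot_pk ha02 hrange _ ((Fk_eq_zero_iff ha θ).1 hθ).2
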